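/- Let $n\ge 1$ and let $p_1\ge p_2\ge\dots\ge p_n\ge 0$ with $\sum_{i=1}^n p_i=1$. A list contains the items $1,\dots,n$; its state is the permutation $\pi$ for which $\pi(i)\in\{1,\dots,n\}$ is the position of item $i$. At each step an item is requested, item $i$ with probability $p_i$, independently of the past; the request costs $\pi(i)$, where $\pi$ is the current state. The Transposition rule then swaps the requested item with its immediate predecessor in the list (and does nothing if the requested item is at position $1$). This defines a Markov chain on the set $S_n$ of permutations, which has a stationary distribution; it is unique if all $p_i$ are positive. For every stationary distribution $\mu$ of this chain, the expected access cost satisfies $$\sum_{\pi\in S_n}\mu(\pi)\sum_{i=1}^n p_i\,\pi(i)\;\le\;\mathrm{OPT}+1,\qquad\text{where } \mathrm{OPT}=\sum_{i=1}^n i\,p_i .$$ -/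

import Mathlib

namespace ListUpdate

/-- The Transposition rule on `n` items. A state is a permutation `π` of `Fin n`, where `π i` is
the current position of item `i` (positions are counted from `0`, the front of the list).
When item `i` is requested, it is swapped with the item immediately in front of it;
nothing happens if `i` is already at the front. -/
def transposition {n : ℕ} (π : Equiv.Perm (Fin n)) (i : Fin n) : Equiv.Perm (Fin n) :=
  if (π i : ℕ) = 0 then π
  else
    Equiv.swap i (π.symm ⟨(π i : ℕ) - 1, lt_of_le_of_lt (Nat.sub_le _ _) (π i).isLt⟩) |>.trans π

/-- The transition matrix of the Markov chain on the permutations that Transposition induces when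
requests are independent and item `i` is requested with probability `p i`. -/
def transitionMatrix {n : ℕ} (p : Fin n → ℝ) :
    Matrix (Equiv.Perm (Fin n)) (Equiv.Perm (Fin n)) ℝ :=
  fun π σ => ∑ i : Fin n, if transposition π i = σ then p i else 0

/-- `μ` is a stationary distribution of the Transposition chain: a probability vector on the
permutations that the transition matrix leaves invariant. -/
def IsStationary {n : ℕ} (p : Fin n → ℝ) (μ : Equiv.Perm (Fin n) → ℝ) : Prop :=
  μ ∈ stdSimplex ℝ (Equiv.Perm (Fin n)) ∧ Matrix.vecMul μ (transitionMatrix p) = μ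

/-- The expected access cost in the state `π`. Accessing item `i` costs its position in the list,
counted from `1`. -/
def cost {n : ℕ} (p : Fin n → ℝ) (π : Equiv.Perm (Fin n)) : ℝ :=
  ∑ i : Fin n, p i * (((π i : ℕ) : ℝ) + 1)

/-- The expected access cost when the state is distributed according to `μ`. -/
def expectedCost {n : ℕ} (p : Fin n → ℝ) (μ : Equiv.Perm (Fin n) → ℝ) : ℝ :=
  ∑ π : Equiv.Perm (Fin n), μ π * cost p π

/-- The expected access cost `∑ i * p_i` of the ordering by decreasing probabilities, for
probabilities that are listed in decreasing order. -/
def opt {n : ℕ} (p : Fin n → ℝ) : ℝ :=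
  ∑ i : Fin n, (((i : ℕ) : ℝ) + 1) * p i

end ListUpdate

/-!
The product weights `∏ i, p i ^ (-σ i)` satisfy detailed balance, so a stationary distribution `μ`
is a multiple of them on each communicating class, and exchanging two items at distance `d`
multiplies `μ` by the `d`-th power of the ratio of their probabilities. The excess of the cost over
`opt` is the sum of `p j - p i` over the pairs `j < i` with `σ i < σ j`. Fix `i`, let `B` be the set
of such `j` and `L ∈ B` the one nearest the front. Exchanging `L` with `j ∈ B` shows that on average
`p j` is at most `p L`; exchanging `i` with `L` is injective, removes exactly `L` from `B`, and
changes `μ` by a factor of at least `p L / p i`. Hence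
`𝔼 ∑ j ∈ B, p j ≤ 𝔼 (#B * p L) ≤ p i * 𝔼 (#B + 1)`: item `i` contributes at most `p i` to the
excess. Items of probability zero make the chain reducible, but in equilibrium they are at the end
of the list.
-/

namespace ListUpdate

open Finset Equiv
open scoped Matrix
open Matrix (rowStochastic mem_rowStochastic_iff_sum nonneg_of_mem_rowStochastic
  sum_row_of_mem_rowStochastic)

section Chain

variable {α R : Type*}

/-- The vector `w` and the transition matrix `K` satisfy detailed balance: `w` gives each transition
of the chain the same weight as its reversal. -/
def DetailedBalance [Mul R] (K : Matrix α α R) (w : α → R) : Prop :=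
  ∀ x y, w x * K x y = w y * K y x

variable [Fintype α]

lemma DetailedBalance.vecMul_eq [NonAssocSemiring R] {K : Matrix α α R} {w : α → R}
    (hw : DetailedBalance K w) (hK : ∀ x, ∑ y, K x y = 1) : w ᵥ* K = w := by
  funext y
  calc ∑ x, w x * K x y = ∑ x, w y * K y x := sum_congr rfl fun x _ => hw x y
    _ = w y := by rw [← mul_sum, hK, mul_one]

lemma eq_zero_of_sum_sum_eq_zero {β : Type*} [Fintype β] [AddCommMonoid R] [PartialOrder R]
    [IsOrderedAddMonoid R] {F : α → β → R} (hF : ∀ x y, 0 ≤ F x y) (h : ∑ x, ∑ y, F x y = 0)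
    (x : α) (y : β) : F x y = 0 := by
  rw [← Fintype.sum_prod_type', sum_eq_zero_iff_of_nonneg fun z _ => hF z.1 z.2] at h
  exact h (x, y) (mem_univ _)

lemma sum_mul_sub_eq_zero_of_vecMul_eq [NonAssocRing R] {K : Matrix α α R} {μ : α → R}
    (hμ : μ ᵥ* K = μ) (hK : ∀ x, ∑ y, K x y = 1) (g : α → R) :
    ∑ x, ∑ y, μ x * K x y * (g y - g x) = 0 := by
  have hsource : ∑ x, ∑ y, μ x * K x y * g x = ∑ x, μ x * g x :=
    sum_congr rfl fun x _ => by rw [← sum_mul, ← mul_sum, hK, mul_one]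
  have htarget : ∑ x, ∑ y, μ x * K x y * g y = ∑ y, μ y * g y := by
    rw [sum_comm]
    exact sum_congr rfl fun y _ => by rw [← sum_mul, ← congrFun hμ y]; rfl
  simp only [mul_sub, sum_sub_distrib, hsource, htarget, sub_self]

variable [CommRing R] {K : Matrix α α R}

lemma DetailedBalance.sum_mul_sq_sub_eq_zero {w f : α → R} (hw : DetailedBalance K w)
    (hK : ∀ x, ∑ y, K x y = 1) (hf : (w * f) ᵥ* K = w * f) :
    ∑ x, ∑ y, w x * K x y * (f x - f y) ^ 2 = 0 := by
  have hsq := sum_mul_sub_eq_zero_of_vecMul_eq (hw.vecMul_eq hK) hK (f ^ 2)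
  have hmul := sum_mul_sub_eq_zero_of_vecMul_eq hf hK f
  calc ∑ x, ∑ y, w x * K x y * (f x - f y) ^ 2
      = ∑ x, ∑ y, w x * K x y * ((f ^ 2) y - (f ^ 2) x) -
          2 * ∑ x, ∑ y, (w * f) x * K x y * (f y - f x) := by
        simp only [mul_sum, ← sum_sub_distrib, Pi.mul_apply, Pi.pow_apply]
        exact sum_congr rfl fun x _ => sum_congr rfl fun y _ => by ring
    _ = 0 := by rw [hsq, hmul, mul_zero, sub_zero]

variable [LinearOrder R] [IsStrictOrderedRing R] [DecidableEq α]

lemma eq_of_vecMul_eq_of_le {μ g : α → R} (hμ : μ ᵥ* K = μ) (hμ_nonneg : ∀ x, 0 ≤ μ x)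
    (hK : K ∈ rowStochastic R α) (hg : ∀ x y, 0 < K x y → g x ≤ g y) {x y : α}
    (hx : μ x ≠ 0) (hxy : 0 < K x y) : g x = g y := by
  have hterm : ∀ x y, 0 ≤ μ x * K x y * (g y - g x) := fun x y => by
    rcases (nonneg_of_mem_rowStochastic hK).eq_or_lt with h | h
    · rw [← h, mul_zero, zero_mul]
    · exact mul_nonneg (mul_nonneg (hμ_nonneg x) h.le) (sub_nonneg.2 (hg x y h))
  have hzero := eq_zero_of_sum_sum_eq_zero hterm
    (sum_mul_sub_eq_zero_of_vecMul_eq hμ (sum_row_of_mem_rowStochastic hK) g) x y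
  exact (sub_eq_zero.1 ((mul_eq_zero.1 hzero).resolve_left (mul_ne_zero hx hxy.ne'))).symm

lemma DetailedBalance.eq_of_vecMul_eq {w f : α → R} (hw : DetailedBalance K w)
    (hw_nonneg : ∀ x, 0 ≤ w x) (hK : K ∈ rowStochastic R α) (hf : (w * f) ᵥ* K = w * f) {x y : α}
    (hx : w x ≠ 0) (hxy : K x y ≠ 0) : f x = f y := by
  have hzero := eq_zero_of_sum_sum_eq_zero
    (fun x y => mul_nonneg (mul_nonneg (hw_nonneg x) (nonneg_of_mem_rowStochastic hK))
      (sq_nonneg (f x - f y)))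
    (hw.sum_mul_sq_sub_eq_zero (sum_row_of_mem_rowStochastic hK) hf) x y
  exact sub_eq_zero.1 (pow_eq_zero_iff two_ne_zero |>.1
    ((mul_eq_zero.1 hzero).resolve_left (mul_ne_zero hx hxy)))

end Chain

variable {n : ℕ} {p : Fin n → ℝ} {σ τ : Perm (Fin n)} {i j x y : Fin n}

section Transposition

/-- The item immediately in front of `j`, or `j` itself if `j` is at the front. -/
def pred (σ : Perm (Fin n)) (j : Fin n) : Fin n :=
  σ.symm ⟨(σ j : ℕ) - 1, lt_of_le_of_lt (Nat.sub_le _ _) (σ j).isLt⟩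

lemma apply_pred (σ : Perm (Fin n)) (j : Fin n) : (σ (pred σ j) : ℕ) = σ j - 1 := by
  simp [pred]

lemma apply_pred_le (σ : Perm (Fin n)) (j : Fin n) : σ (pred σ j) ≤ σ j := by
  rw [Fin.le_def, apply_pred]
  exact Nat.sub_le _ _

lemma pred_eq (h : (σ x : ℕ) = σ y - 1) : pred σ y = x :=
  σ.injective (Fin.ext ((apply_pred σ y).trans h.symm))

lemma transposition_eq (σ : Perm (Fin n)) (j : Fin n) :
    transposition σ j = σ * swap j (pred σ j) := by
  unfold transposition
  split_ifs with h
  · rw [pred_eq (x := j) (by omega), swap_self, ← Perm.one_def, mul_one]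
  · rfl

lemma transposition_eq_mul_swap (h : (σ y : ℕ) = σ x + 1) :
    transposition σ y = σ * swap x y := by
  rw [transposition_eq, pred_eq (x := x) (by omega), swap_comm]

lemma pred_transposition (σ : Perm (Fin n)) (j : Fin n) :
    pred (transposition σ j) (pred σ j) = j := by
  apply pred_eq
  simp only [transposition_eq, Perm.mul_apply, swap_apply_left, swap_apply_right, apply_pred]

lemma transposition_transposition (σ : Perm (Fin n)) (j : Fin n) :
    transposition (transposition σ j) (pred σ j) = σ := by
  rw [transposition_eq (transposition σ j), pred_transposition, transposition_eq, swap_comm j,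
    mul_assoc, swap_mul_self, mul_one]

lemma le_transposition (h : i ≠ j) : σ i ≤ transposition σ j i := by
  rw [transposition_eq, Perm.mul_apply]
  by_cases hi : i = pred σ j
  · rw [hi, swap_apply_right]
    exact apply_pred_le σ j
  · rw [swap_apply_of_ne_of_ne h hi]

lemma transitionMatrix_mem_rowStochastic (hp : p ∈ stdSimplex ℝ (Fin n)) :
    transitionMatrix p ∈ rowStochastic ℝ (Perm (Fin n)) := by
  refine mem_rowStochastic_iff_sum.2 ⟨fun σ τ => sum_nonneg fun i _ => ?_, fun σ => ?_⟩
  · split_ifs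
    exacts [hp.1 i, le_rfl]
  · unfold transitionMatrix
    rw [sum_comm]
    simpa only [sum_ite_eq, mem_univ, if_true] using hp.2

lemma le_transitionMatrix (hp : ∀ i, 0 ≤ p i) (σ : Perm (Fin n)) (j : Fin n) :
    p j ≤ transitionMatrix p σ (transposition σ j) := by
  have hterm : ∀ i ∈ univ, 0 ≤ if transposition σ i = transposition σ j then p i else 0 :=
    fun i _ => by split_ifs; exacts [hp i, le_rfl]
  calc p j = if transposition σ j = transposition σ j then p j else 0 := (if_pos rfl).symm
    _ ≤ transitionMatrix p σ (transposition σ j) := single_le_sum hterm (mem_univ j)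

lemma exists_transposition_eq_of_transitionMatrix_ne_zero (h : transitionMatrix p σ τ ≠ 0) :
    ∃ j, p j ≠ 0 ∧ transposition σ j = τ := by
  obtain ⟨j, -, hj⟩ := exists_ne_zero_of_sum_ne_zero h
  rw [ite_ne_right_iff] at hj
  exact ⟨j, hj.2, hj.1⟩

end Transposition

section Weight

/-- In the state `σ` the items of probability zero are at the end of the list. These are the
recurrent states of the chain. -/
def ZerosLast (p : Fin n → ℝ) (σ : Perm (Fin n)) : Prop :=
  ∀ ⦃x y⦄, σ x ≤ σ y → p x = 0 → p y = 0

lemma zerosLast_of_pred (h : ∀ j, p (pred σ j) = 0 → p j = 0) : ZerosLast p σ := by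
  have key : ∀ (d : ℕ) (x y : Fin n), (σ y : ℕ) = σ x + d → p x = 0 → p y = 0 := by
    intro d
    induction d with
    | zero => exact fun x y hd hx => σ.injective (Fin.ext hd) ▸ hx
    | succ d ih => exact fun x y hd hx => h y (ih x (pred σ y) (by rw [apply_pred]; omega) hx)
  exact fun x y hxy => key (σ y - σ x) x y (Nat.add_sub_of_le hxy).symm

lemma exists_zerosLast (hp : ∀ i, 0 ≤ p i) : ∃ σ, ZerosLast p σ := by
  refine ⟨(Tuple.sort (-p)).symm, fun x y hxy hx => (hp y).antisymm' ?_⟩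
  have h := Tuple.monotone_sort (-p) hxy
  simpa [hx] using h

lemma ZerosLast.mul_swap (h : ZerosLast p σ) (hx : p x ≠ 0) (hy : p y ≠ 0) :
    ZerosLast p (σ * swap x y) := by
  have hswap : ∀ a, p (swap x y a) = 0 ↔ p a = 0 := fun a => by
    rw [swap_apply_def]
    split_ifs with hax hay
    · simp [hax, hx, hy]
    · simp [hay, hx, hy]
    · rfl
  exact fun a b hab ha => (hswap b).1 (h hab ((hswap a).2 ha))

lemma zerosLast_mul_swap_iff (hx : p x ≠ 0) (hy : p y ≠ 0) :
    ZerosLast p (σ * swap x y) ↔ ZerosLast p σ := by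
  refine ⟨fun h => ?_, fun h => h.mul_swap hx hy⟩
  simpa [mul_assoc] using h.mul_swap hx hy

lemma prod_pow_comp_swap {ι M : Type*} [DecidableEq ι] [CommMonoid M] (r : ι → M) {e : ι → ℕ}
    {s : Finset ι} {x y : ι} (hx : x ∈ s) (hy : y ∈ s) {d : ℕ} (hd : e y = e x + d) :
    (∏ i ∈ s, r i ^ e (swap x y i)) * r y ^ d = (∏ i ∈ s, r i ^ e i) * r x ^ d := by
  rcases eq_or_ne x y with rfl | hxy
  · simp
  have hrest : ∏ i ∈ (s.erase x).erase y, r i ^ e (swap x y i) =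
      ∏ i ∈ (s.erase x).erase y, r i ^ e i := by
    refine prod_congr rfl fun i hi => ?_
    simp only [mem_erase] at hi
    rw [swap_apply_of_ne_of_ne hi.2.1 hi.1]
  have hy' : y ∈ s.erase x := mem_erase.2 ⟨hxy.symm, hy⟩
  rw [← mul_prod_erase s _ hx, ← mul_prod_erase s _ hx, ← mul_prod_erase _ _ hy',
    ← mul_prod_erase _ _ hy', hrest, swap_apply_left, swap_apply_right, hd, pow_add, pow_add]
  ac_rfl

open Classical in
/-- The reversible measure of the chain on the states in which the items of probability zero come
last, not normalised. -/
noncomputable def weight (p : Fin n → ℝ) (σ : Perm (Fin n)) : ℝ :=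
  if ZerosLast p σ then ∏ i with p i ≠ 0, (p i)⁻¹ ^ (σ i : ℕ) else 0

lemma weight_pos (hp : ∀ i, 0 ≤ p i) (h : ZerosLast p σ) : 0 < weight p σ := by
  rw [weight, if_pos h]
  refine prod_pos fun i hi => pow_pos (inv_pos.2 ((hp i).lt_of_ne' ?_)) _
  simpa using hi

lemma weight_of_not_zerosLast (h : ¬ ZerosLast p σ) : weight p σ = 0 := if_neg h

lemma weight_nonneg (hp : ∀ i, 0 ≤ p i) (σ : Perm (Fin n)) : 0 ≤ weight p σ := by
  by_cases h : ZerosLast p σ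
  exacts [(weight_pos hp h).le, (weight_of_not_zerosLast h).ge]

lemma sum_weight_pos (hp : ∀ i, 0 ≤ p i) : 0 < ∑ σ, weight p σ := by
  obtain ⟨σ, hσ⟩ := exists_zerosLast hp
  exact sum_pos' (fun τ _ => weight_nonneg hp τ) ⟨σ, mem_univ σ, weight_pos hp hσ⟩

lemma weight_mul_swap (hx : p x ≠ 0) (hy : p y ≠ 0) {d : ℕ} (hd : (σ y : ℕ) = σ x + d) :
    weight p (σ * swap x y) * p x ^ d = weight p σ * p y ^ d := by
  rw [weight, weight, zerosLast_mul_swap_iff hx hy]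
  split_ifs with h
  · have hprod := prod_pow_comp_swap p⁻¹ (e := fun i => (σ i : ℕ))
      (s := univ.filter fun i => p i ≠ 0) (by simpa using hx) (by simpa using hy) hd
    simp only [Pi.inv_apply, inv_pow _ d, ← div_eq_mul_inv] at hprod
    rwa [div_eq_div_iff (pow_ne_zero d hy) (pow_ne_zero d hx)] at hprod
  · rw [zero_mul, zero_mul]

lemma weight_mul_eq_zero (h : p (pred σ j) = 0) : weight p σ * p j = 0 := by
  by_cases hσ : ZerosLast p σ
  · rw [hσ (apply_pred_le σ j) h, mul_zero]
  · rw [weight_of_not_zerosLast hσ, zero_mul]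

lemma weight_transposition (p : Fin n → ℝ) (σ : Perm (Fin n)) (j : Fin n) :
    weight p (transposition σ j) * p (pred σ j) = weight p σ * p j := by
  by_cases hq : p (pred σ j) = 0
  · rw [hq, mul_zero, weight_mul_eq_zero hq]
  by_cases hj : p j = 0
  · rw [hj, mul_zero]
    exact weight_mul_eq_zero (by rwa [pred_transposition])
  rcases Nat.eq_zero_or_pos (σ j : ℕ) with h | h
  · rw [pred_eq (x := j) (by omega), transposition, if_pos h]
  · rw [transposition_eq, swap_comm]
    simpa only [pow_one] using weight_mul_swap hq hj (d := 1) (by rw [apply_pred]; omega)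

lemma detailedBalance_weight (p : Fin n → ℝ) :
    DetailedBalance (transitionMatrix p) (weight p) := by
  intro σ τ
  simp only [transitionMatrix, ← sum_filter, mul_sum]
  refine sum_nbij' (pred σ) (pred τ) ?_ ?_ ?_ ?_ ?_ <;>
    simp only [mem_filter, mem_univ, true_and]
  · rintro j rfl
    exact transposition_transposition σ j
  · rintro j rfl
    exact transposition_transposition τ j
  · rintro j rfl
    exact pred_transposition σ j
  · rintro j rfl
    exact pred_transposition τ j
  · rintro j rfl
    exact (weight_transposition p σ j).symm

lemma isStationary_weight_div_sum (hp : p ∈ stdSimplex ℝ (Fin n)) :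
    IsStationary p fun σ => weight p σ / ∑ τ, weight p τ := by
  have hpos := sum_weight_pos hp.1
  refine ⟨⟨fun σ => div_nonneg (weight_nonneg hp.1 σ) hpos.le, ?_⟩, ?_⟩
  · rw [← sum_div, div_self hpos.ne']
  · refine DetailedBalance.vecMul_eq (fun σ τ => ?_)
      (sum_row_of_mem_rowStochastic (transitionMatrix_mem_rowStochastic hp))
    rw [div_mul_eq_mul_div, detailedBalance_weight, div_mul_eq_mul_div]

end Weight

section Stationary

variable {μ : Perm (Fin n) → ℝ}

/- An item of probability zero never moves towards the front, so in equilibrium it does not move at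
all. -/
lemma IsStationary.zerosLast (hμ : IsStationary p μ) (hp : p ∈ stdSimplex ℝ (Fin n))
    (hσ : μ σ ≠ 0) : ZerosLast p σ := by
  let g : Perm (Fin n) → ℝ := fun σ => ∑ z with p z = 0, ((σ z : ℕ) : ℝ)
  have hle : ∀ (σ : Perm (Fin n)) (j : Fin n), p j ≠ 0 →
      ∀ z ∈ univ.filter fun z => p z = 0, ((σ z : ℕ) : ℝ) ≤ (transposition σ j z : ℕ) := by
    intro σ j hj z hz
    have hzj : z ≠ j := by rintro rfl; exact hj (mem_filter.1 hz).2
    exact_mod_cast le_transposition hzj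
  have hg : ∀ σ τ, 0 < transitionMatrix p σ τ → g σ ≤ g τ := by
    intro σ τ hστ
    obtain ⟨j, hj, rfl⟩ := exists_transposition_eq_of_transitionMatrix_ne_zero hστ.ne'
    exact sum_le_sum (hle σ j hj)
  refine zerosLast_of_pred fun j hq => by_contra fun hj => ?_
  have hstep : 0 < transitionMatrix p σ (transposition σ j) :=
    ((hp.1 j).lt_of_ne' hj).trans_le (le_transitionMatrix hp.1 σ j)
  have heq : g σ = g (transposition σ j) :=
    eq_of_vecMul_eq_of_le hμ.2 hμ.1.1 (transitionMatrix_mem_rowStochastic hp) hg hσ hstep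
  have hfix : ((σ (pred σ j) : ℕ) : ℝ) = (transposition σ j (pred σ j) : ℕ) :=
    (sum_eq_sum_iff_of_le (hle σ j hj)).1 heq _ (by simpa using hq)
  rw [transposition_eq, Perm.mul_apply, swap_apply_right, Nat.cast_inj] at hfix
  exact hj (σ.injective (Fin.ext hfix) ▸ hq)

lemma IsStationary.weight_mul_div (hμ : IsStationary p μ) (hp : p ∈ stdSimplex ℝ (Fin n))
    (σ : Perm (Fin n)) : weight p σ * (μ σ / weight p σ) = μ σ :=
  mul_div_cancel_of_imp' fun h => by_contra fun hσ =>
    (weight_pos hp.1 (hμ.zerosLast hp hσ)).ne' h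

lemma IsStationary.div_weight_transposition (hμ : IsStationary p μ)
    (hp : p ∈ stdSimplex ℝ (Fin n)) (hσ : ZerosLast p σ) (hj : p j ≠ 0) :
    μ (transposition σ j) / weight p (transposition σ j) = μ σ / weight p σ := by
  have hf : weight p * (μ / weight p) = μ := funext (hμ.weight_mul_div hp)
  have hstep : transitionMatrix p σ (transposition σ j) ≠ 0 :=
    (((hp.1 j).lt_of_ne' hj).trans_le (le_transitionMatrix hp.1 σ j)).ne'
  exact ((detailedBalance_weight p).eq_of_vecMul_eq (f := μ / weight p) (weight_nonneg hp.1)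
    (transitionMatrix_mem_rowStochastic hp) (by rw [hf, hμ.2]) (weight_pos hp.1 hσ).ne' hstep).symm

/- The exchange of `x` and `y` is composed of exchanges of neighbours: with `z` the predecessor of
`y`, exchange `z` and `y`, then `x` and `y` at the smaller distance, then `x` and `z`. -/
lemma IsStationary.div_weight_mul_swap_of_le (hμ : IsStationary p μ)
    (hp : p ∈ stdSimplex ℝ (Fin n)) (hσ : ZerosLast p σ) (hx : p x ≠ 0) (hy : p y ≠ 0)
    (hxy : σ x ≤ σ y) : μ (σ * swap x y) / weight p (σ * swap x y) = μ σ / weight p σ := by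
  have hadj : ∀ {τ : Perm (Fin n)} {a b : Fin n}, ZerosLast p τ → p b ≠ 0 → (τ b : ℕ) = τ a + 1 →
      μ (τ * swap a b) / weight p (τ * swap a b) = μ τ / weight p τ := fun hτ hb hab =>
    transposition_eq_mul_swap hab ▸ hμ.div_weight_transposition hp hτ hb
  obtain ⟨d, hd⟩ : ∃ d, (σ y : ℕ) = σ x + d := Nat.exists_eq_add_of_le hxy
  clear hxy
  induction d generalizing σ with
  | zero => rw [σ.injective (Fin.ext hd), swap_self, ← Perm.one_def, mul_one]
  | succ d ih =>
    rcases Nat.eq_zero_or_pos d with rfl | hd0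
    · exact hadj hσ hy hd
    set z := pred σ y with hz
    have hσz : (σ z : ℕ) = σ x + d := by rw [hz, apply_pred]; omega
    have hzx : z ≠ x := by intro h; rw [h] at hσz; omega
    have hzy : z ≠ y := by intro h; rw [h] at hσz; omega
    have hxy : x ≠ y := by rintro rfl; omega
    have hpz : p z ≠ 0 := fun h => hy (hσ (apply_pred_le σ y) h)
    have hswap : σ * swap z y * swap x y * swap x z = σ * swap x y := by
      rw [← swap_mul_swap_mul_swap hzy hzx, swap_comm y x]
      simp [mul_assoc]
    have hσ₁ : ZerosLast p (σ * swap z y) := hσ.mul_swap hpz hy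
    rw [← hswap, hadj (hσ₁.mul_swap hx hy) hpz, ih hσ₁, hadj hσ hy]
    · omega
    · simp [swap_apply_of_ne_of_ne hzx.symm hxy, hσz]
    · simp [swap_apply_of_ne_of_ne hzx hzy, hσz, hd, add_assoc]

lemma IsStationary.div_weight_mul_swap (hμ : IsStationary p μ) (hp : p ∈ stdSimplex ℝ (Fin n))
    (hx : p x ≠ 0) (hy : p y ≠ 0) (σ : Perm (Fin n)) :
    μ (σ * swap x y) / weight p (σ * swap x y) = μ σ / weight p σ := by
  by_cases hσ : ZerosLast p σ
  · rcases le_total (σ x) (σ y) with hxy | hyx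
    · exact hμ.div_weight_mul_swap_of_le hp hσ hx hy hxy
    · rw [swap_comm]
      exact hμ.div_weight_mul_swap_of_le hp hσ hy hx hyx
  · rw [weight_of_not_zerosLast hσ,
      weight_of_not_zerosLast ((zerosLast_mul_swap_iff hx hy).not.2 hσ), div_zero, div_zero]

lemma IsStationary.eq_weight_div_sum (hμ : IsStationary p μ) (hp : p ∈ stdSimplex ℝ (Fin n))
    (hp_ne : ∀ i, p i ≠ 0) : μ = fun σ => weight p σ / ∑ τ, weight p τ := by
  have hconst : ∀ σ : Perm (Fin n), μ σ / weight p σ = μ 1 / weight p 1 := by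
    intro σ
    induction σ using Perm.swap_induction_on' with
    | one => rfl
    | mul_swap σ x y _ ih => rw [hμ.div_weight_mul_swap hp (hp_ne x) (hp_ne y), ih]
  have hmul : ∀ σ, μ σ = weight p σ * (μ 1 / weight p 1) := fun σ => by
    rw [← hconst σ, hμ.weight_mul_div hp]
  have hsum : (∑ τ, weight p τ) * (μ 1 / weight p 1) = 1 := by
    rw [sum_mul, ← hμ.1.2]
    exact sum_congr rfl fun σ _ => (hmul σ).symm
  funext σ
  rw [hmul, eq_div_iff (sum_weight_pos hp.1).ne', mul_assoc, mul_comm (μ 1 / _), hsum, mul_one]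

lemma IsStationary.mul_swap (hμ : IsStationary p μ) (hp : p ∈ stdSimplex ℝ (Fin n))
    (hx : p x ≠ 0) (hy : p y ≠ 0) {d : ℕ} (hd : (σ y : ℕ) = σ x + d) :
    μ (σ * swap x y) * p x ^ d = μ σ * p y ^ d := by
  rw [← hμ.weight_mul_div hp (σ * swap x y), hμ.div_weight_mul_swap hp hx hy, mul_right_comm,
    weight_mul_swap hx hy hd, mul_right_comm, hμ.weight_mul_div hp]

lemma IsStationary.le_mul_swap (hμ : IsStationary p μ) (hp : p ∈ stdSimplex ℝ (Fin n))
    (hx : 0 < p x) (hxy : p x ≤ p y) (hσ : σ x ≤ σ y) : μ σ ≤ μ (σ * swap x y) := by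
  obtain ⟨d, hd⟩ : ∃ d, (σ y : ℕ) = σ x + d := Nat.exists_eq_add_of_le hσ
  refine le_of_mul_le_mul_right ?_ (pow_pos hx d)
  calc μ σ * p x ^ d ≤ μ σ * p y ^ d :=
        mul_le_mul_of_nonneg_left (pow_le_pow_left₀ hx.le hxy d) (hμ.1.1 σ)
    _ = μ (σ * swap x y) * p x ^ d := (hμ.mul_swap hp hx.ne' (hx.trans_le hxy).ne' hd).symm

lemma IsStationary.mul_le_mul_swap (hμ : IsStationary p μ) (hp : p ∈ stdSimplex ℝ (Fin n))
    (hx : 0 < p x) (hxy : p x ≤ p y) (hσ : σ x < σ y) :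
    μ σ * p y ≤ μ (σ * swap x y) * p x := by
  obtain ⟨d, hd⟩ : ∃ d, (σ y : ℕ) = σ x + d + 1 := Nat.exists_eq_add_of_lt hσ
  have hy : 0 < p y := hx.trans_le hxy
  refine le_of_mul_le_mul_right ?_ (pow_pos hx d)
  calc μ σ * p y * p x ^ d ≤ μ σ * p y * p y ^ d :=
        mul_le_mul_of_nonneg_left (pow_le_pow_left₀ hx.le hxy d) (mul_nonneg (hμ.1.1 σ) hy.le)
    _ = μ σ * p y ^ (d + 1) := by ring
    _ = μ (σ * swap x y) * p x ^ (d + 1) := (hμ.mul_swap hp hx.ne' hy.ne' hd).symm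
    _ = μ (σ * swap x y) * p x * p x ^ d := by ring

lemma IsStationary.sub_mul_sub_nonneg (hμ : IsStationary p μ) (hp : p ∈ stdSimplex ℝ (Fin n))
    (hx : 0 < p x) (hy : 0 < p y) (hσ : σ x ≤ σ y) :
    0 ≤ (μ σ - μ (σ * swap x y)) * (p x - p y) := by
  rcases le_total (p x) (p y) with h | h
  · exact mul_nonneg_of_nonpos_of_nonpos (sub_nonpos.2 (hμ.le_mul_swap hp hx h hσ))
      (sub_nonpos.2 h)
  · have hle : μ (σ * swap x y) ≤ μ (σ * swap x y * swap y x) :=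
      hμ.le_mul_swap hp hy h (by simpa using hσ)
    rw [swap_comm y, mul_assoc, swap_mul_self, mul_one] at hle
    exact mul_nonneg (sub_nonneg.2 hle) (sub_nonneg.2 h)

end Stationary

section Overtaken

/-- The items that precede `i` in the optimal order but are behind `i` in the list. -/
def overtaken (i : Fin n) (σ : Perm (Fin n)) : Finset (Fin n) :=
  {j | j < i ∧ σ i < σ j}

lemma mem_overtaken : j ∈ overtaken i σ ↔ j < i ∧ σ i < σ j := by
  simp [overtaken]

/-- The contribution of item `i` to the excess of the cost in state `σ` over `opt p`. -/
def excess (p : Fin n → ℝ) (i : Fin n) (σ : Perm (Fin n)) : ℝ :=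
  ∑ j ∈ overtaken i σ, (p j - p i)

lemma val_eq_sum_ite_apply_lt (σ : Perm (Fin n)) (i : Fin n) :
    ((σ i : ℕ) : ℝ) = ∑ j, if σ j < σ i then 1 else 0 := by
  rw [Equiv.sum_comp σ fun b => if b < σ i then (1 : ℝ) else 0, sum_boole, filter_gt_eq_Iio,
    Fin.card_Iio]

lemma ite_apply_lt_sub_ite_lt (σ : Perm (Fin n)) (i j : Fin n) :
    ((if σ j < σ i then 1 else 0) - if j < i then 1 else 0 : ℝ) =
      (if i ∈ overtaken j σ then 1 else 0) - if j ∈ overtaken i σ then 1 else 0 := by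
  simp only [mem_overtaken]
  rcases lt_trichotomy i j with h | rfl | h
  · simp [h, h.not_gt]
  · simp
  · rcases (σ.injective.ne h.ne).lt_or_gt with h' | h' <;> simp [h, h.not_gt, h', h'.not_gt]

lemma cost_eq_opt_add_sum_excess (p : Fin n → ℝ) (σ : Perm (Fin n)) :
    cost p σ = opt p + ∑ i, excess p i σ := by
  have hdisp : ∀ i : Fin n, ((σ i : ℕ) : ℝ) - (i : ℕ) =
      ∑ j, ((if i ∈ overtaken j σ then 1 else 0) - if j ∈ overtaken i σ then 1 else 0) := by
    intro i
    rw [val_eq_sum_ite_apply_lt σ i,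
      show ((i : ℕ) : ℝ) = _ from val_eq_sum_ite_apply_lt 1 i, ← sum_sub_distrib]
    exact sum_congr rfl fun j _ => ite_apply_lt_sub_ite_lt σ i j
  rw [← sub_eq_iff_eq_add']
  calc cost p σ - opt p
      = ∑ i, p i * (((σ i : ℕ) : ℝ) - (i : ℕ)) := by
        rw [cost, opt, ← sum_sub_distrib]
        exact sum_congr rfl fun i _ => by ring
    _ = ∑ i, ∑ j, (if i ∈ overtaken j σ then p i else 0) -
          ∑ i, ∑ j, (if j ∈ overtaken i σ then p i else 0) := by
        simp only [hdisp, mul_sum, mul_sub, mul_ite, mul_one, mul_zero, sum_sub_distrib]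
    _ = ∑ i, ∑ j, (if j ∈ overtaken i σ then p j else 0) -
          ∑ i, ∑ j, (if j ∈ overtaken i σ then p i else 0) := by rw [sum_comm]
    _ = ∑ i, excess p i σ := by
        simp only [excess, sum_sub_distrib, sum_ite_mem, univ_inter]

lemma overtaken_mul_swap (hx : x ∈ overtaken i σ) (hy : y ∈ overtaken i σ) :
    overtaken i (σ * swap x y) = overtaken i σ := by
  rw [mem_overtaken] at hx hy
  ext a
  rw [mem_overtaken, mem_overtaken, Perm.mul_apply, Perm.mul_apply,
    swap_apply_of_ne_of_ne hx.1.ne' hy.1.ne', swap_apply_def]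
  split_ifs with hax hay
  · simp [hax, hx, hy]
  · simp [hay, hx, hy]
  · rfl

/-- The element of `overtaken i σ` nearest the front of the list. By convention it is `i` if there
is none. -/
noncomputable def firstOvertaken (i : Fin n) (σ : Perm (Fin n)) : Fin n :=
  if h : (overtaken i σ).Nonempty then (exists_min_image (overtaken i σ) σ h).choose else i

lemma firstOvertaken_mem (h : (overtaken i σ).Nonempty) : firstOvertaken i σ ∈ overtaken i σ := by
  rw [firstOvertaken, dif_pos h]
  exact (exists_min_image (overtaken i σ) σ h).choose_spec.1

lemma apply_firstOvertaken_le (hj : j ∈ overtaken i σ) : σ (firstOvertaken i σ) ≤ σ j := by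
  have h : (overtaken i σ).Nonempty := ⟨j, hj⟩
  rw [firstOvertaken, dif_pos h]
  exact (exists_min_image (overtaken i σ) σ h).choose_spec.2 j hj

lemma firstOvertaken_eq (hx : x ∈ overtaken i σ) (hmin : ∀ j ∈ overtaken i σ, σ x ≤ σ j) :
    firstOvertaken i σ = x :=
  σ.injective (le_antisymm (apply_firstOvertaken_le hx) (hmin _ (firstOvertaken_mem ⟨x, hx⟩)))

lemma firstOvertaken_mul_swap (hj : j ∈ overtaken i σ) :
    firstOvertaken i (σ * swap (firstOvertaken i σ) j) = j := by
  have hB := overtaken_mul_swap (firstOvertaken_mem ⟨j, hj⟩) hj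
  refine firstOvertaken_eq (hB ▸ hj) fun a ha => ?_
  rw [hB] at ha
  rw [Perm.mul_apply, swap_apply_right, Perm.mul_apply, swap_apply_def]
  split_ifs
  exacts [apply_firstOvertaken_le hj, le_rfl, apply_firstOvertaken_le ha]

/-- The state obtained from `σ` by exchanging `i` with the first item that it has overtaken. -/
noncomputable def swapFirst (i : Fin n) (σ : Perm (Fin n)) : Perm (Fin n) :=
  σ * swap i (firstOvertaken i σ)

lemma overtaken_swapFirst (h : (overtaken i σ).Nonempty) :
    overtaken i (swapFirst i σ) = (overtaken i σ).erase (firstOvertaken i σ) := by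
  have hL := mem_overtaken.1 (firstOvertaken_mem h)
  ext a
  rw [mem_erase, mem_overtaken, swapFirst, Perm.mul_apply, Perm.mul_apply, swap_apply_left,
    swap_apply_def]
  split_ifs with hai haL
  · simp [hai, mem_overtaken]
  · simp [haL, hL.2.le]
  · constructor
    · rintro ⟨h1, h2⟩
      exact ⟨haL, mem_overtaken.2 ⟨h1, hL.2.trans h2⟩⟩
    · rintro ⟨-, ha⟩
      exact ⟨(mem_overtaken.1 ha).1, (apply_firstOvertaken_le ha).lt_of_ne'
        (σ.injective.ne haL)⟩

lemma apply_le_of_swapFirst_eq (hτ : (overtaken i τ).Nonempty)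
    (h : swapFirst i σ = swapFirst i τ) : τ i ≤ σ i := by
  have hM := mem_overtaken.1 (firstOvertaken_mem hτ)
  have happly : ∀ a, σ (swap i (firstOvertaken i σ) a) = τ (swap i (firstOvertaken i τ) a) :=
    DFunLike.congr_fun h
  set L := firstOvertaken i σ
  set M := firstOvertaken i τ
  by_cases hML : M = L
  · simpa [hML] using (happly L).ge
  by_contra! hlt
  have hi : σ L = τ M := by simpa using happly i
  have hσM : σ M = τ i := by
    simpa [swap_apply_of_ne_of_ne hM.1.ne hML] using happly M
  have hle : σ L ≤ σ M := apply_firstOvertaken_le (mem_overtaken.2 ⟨hM.1, by rwa [hσM]⟩)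
  rw [hi, hσM] at hle
  exact hle.not_gt hM.2

lemma injOn_swapFirst (i : Fin n) :
    Set.InjOn (swapFirst i) {σ | (overtaken i σ).Nonempty} := by
  intro σ hσ τ hτ h
  have hi : σ i = τ i :=
    le_antisymm (apply_le_of_swapFirst_eq hσ h.symm) (apply_le_of_swapFirst_eq hτ h)
  have hL : firstOvertaken i σ = firstOvertaken i τ := by
    apply (swapFirst i σ).injective
    conv_rhs => rw [h]
    simp [swapFirst, hi]
  rw [swapFirst, swapFirst, hL] at h
  exact mul_right_cancel h

end Overtaken

section Excess

variable {μ : Perm (Fin n) → ℝ}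

lemma sum_nonneg_of_add_involution_nonneg {ι R : Type*} [AddCommGroup R] [LinearOrder R]
    [IsOrderedAddMonoid R] {s : Finset ι} {G : ι → R} {φ : ι → ι} (hφ : ∀ a ∈ s, φ a ∈ s)
    (hφφ : ∀ a ∈ s, φ (φ a) = a) (hG : ∀ a ∈ s, 0 ≤ G a + G (φ a)) : 0 ≤ ∑ a ∈ s, G a := by
  have hsum : ∑ a ∈ s, G (φ a) = ∑ a ∈ s, G a := sum_nbij' φ φ hφ hφ hφφ hφφ fun _ _ => rfl
  have h := sum_nonneg hG
  rw [sum_add_distrib, hsum, ← two_nsmul] at h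
  exact (nsmul_nonneg_iff two_ne_zero).1 h

lemma IsStationary.sum_overtaken_le_sum_card_mul (hμ : IsStationary p μ)
    (hp : p ∈ stdSimplex ℝ (Fin n)) (hp_anti : Antitone p) (hi : 0 < p i) :
    ∑ σ, μ σ * ∑ j ∈ overtaken i σ, p j ≤
      ∑ σ, μ σ * (#(overtaken i σ) * p (firstOvertaken i σ)) := by
  let S : Finset (Σ _ : Perm (Fin n), Fin n) := univ.sigma (overtaken i)
  let φ : (Σ _ : Perm (Fin n), Fin n) → Σ _ : Perm (Fin n), Fin n := fun s =>
    ⟨s.1 * swap (firstOvertaken i s.1) s.2, firstOvertaken i s.1⟩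
  let G : (Σ _ : Perm (Fin n), Fin n) → ℝ := fun s =>
    μ s.1 * (p (firstOvertaken i s.1) - p s.2)
  have hS : ∀ s, s ∈ S ↔ s.2 ∈ overtaken i s.1 := fun s => by simp [S]
  have hφ_mem : ∀ s ∈ S, φ s ∈ S := by
    intro s hs
    rw [hS] at hs ⊢
    have hL := firstOvertaken_mem ⟨_, hs⟩
    simpa only [φ, overtaken_mul_swap hL hs] using hL
  have hφ_invol : ∀ s ∈ S, φ (φ s) = s := by
    intro s hs
    simp only [φ, firstOvertaken_mul_swap ((hS s).1 hs)]
    rw [swap_comm s.2, mul_assoc, swap_mul_self, mul_one]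
  have hpair : ∀ s ∈ S, 0 ≤ G s + G (φ s) := by
    intro s hs
    rw [hS] at hs
    have hpos : ∀ j ∈ overtaken i s.1, 0 < p j := fun j hj =>
      hi.trans_le (hp_anti (mem_overtaken.1 hj).1.le)
    have h := hμ.sub_mul_sub_nonneg hp (hpos _ (firstOvertaken_mem ⟨_, hs⟩)) (hpos _ hs)
      (apply_firstOvertaken_le hs)
    simp only [G, φ, firstOvertaken_mul_swap hs]
    linarith
  have hnonneg : 0 ≤ ∑ s ∈ S, G s :=
    sum_nonneg_of_add_involution_nonneg hφ_mem hφ_invol hpair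
  rw [← sub_nonneg, ← sum_sub_distrib]
  simpa only [S, G, sum_sigma, ← mul_sum, sum_sub_distrib, sum_const, nsmul_eq_mul, mul_sub]
    using hnonneg

lemma IsStationary.mul_le_swapFirst_mul (hμ : IsStationary p μ) (hp : p ∈ stdSimplex ℝ (Fin n))
    (hp_anti : Antitone p) (hi : 0 < p i) (hσ : (overtaken i σ).Nonempty) :
    μ σ * (#(overtaken i σ) * p (firstOvertaken i σ)) ≤
      μ (swapFirst i σ) * p i * (#(overtaken i (swapFirst i σ)) + 1) := by
  have hL := mem_overtaken.1 (firstOvertaken_mem hσ)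
  rw [overtaken_swapFirst hσ, mul_left_comm, mul_comm (_ * p i),
    ← Nat.cast_add_one, card_erase_add_one (firstOvertaken_mem hσ)]
  exact mul_le_mul_of_nonneg_left (hμ.mul_le_mul_swap hp hi (hp_anti hL.1.le) hL.2)
    (Nat.cast_nonneg _)

lemma IsStationary.sum_card_mul_le (hμ : IsStationary p μ) (hp : p ∈ stdSimplex ℝ (Fin n))
    (hp_anti : Antitone p) (hi : 0 < p i) :
    ∑ σ, μ σ * (#(overtaken i σ) * p (firstOvertaken i σ)) ≤
      ∑ σ, μ σ * p i * (#(overtaken i σ) + 1) := by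
  let S : Finset (Perm (Fin n)) := {σ | (overtaken i σ).Nonempty}
  let G : Perm (Fin n) → ℝ := fun σ => μ σ * p i * (#(overtaken i σ) + 1)
  have hS : ∀ σ, σ ∈ S ↔ (overtaken i σ).Nonempty := fun σ => by simp [S]
  calc ∑ σ, μ σ * (#(overtaken i σ) * p (firstOvertaken i σ))
      = ∑ σ ∈ S, μ σ * (#(overtaken i σ) * p (firstOvertaken i σ)) := by
        refine (sum_subset (subset_univ S) fun σ _ hσ => ?_).symm
        rw [hS, not_nonempty_iff_eq_empty] at hσ
        simp [hσ]
    _ ≤ ∑ σ ∈ S, G (swapFirst i σ) :=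
        sum_le_sum fun σ hσ => hμ.mul_le_swapFirst_mul hp hp_anti hi ((hS σ).1 hσ)
    _ = ∑ σ ∈ S.image (swapFirst i), G σ :=
        (sum_image fun σ hσ τ hτ => injOn_swapFirst i ((hS σ).1 hσ) ((hS τ).1 hτ)).symm
    _ ≤ ∑ σ, G σ := sum_le_sum_of_subset_of_nonneg (subset_univ _) fun σ _ _ =>
        mul_nonneg (mul_nonneg (hμ.1.1 σ) hi.le) (by positivity)

lemma IsStationary.mul_excess_eq_zero (hμ : IsStationary p μ) (hp : p ∈ stdSimplex ℝ (Fin n))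
    (hi : p i = 0) (σ : Perm (Fin n)) : μ σ * excess p i σ = 0 := by
  by_cases hσ : μ σ = 0
  · rw [hσ, zero_mul]
  refine mul_eq_zero_of_right _ (sum_eq_zero fun j hj => ?_)
  rw [hμ.zerosLast hp hσ (mem_overtaken.1 hj).2.le hi, hi, sub_zero]

lemma IsStationary.sum_mul_excess_le (hμ : IsStationary p μ) (hp : p ∈ stdSimplex ℝ (Fin n))
    (hp_anti : Antitone p) (i : Fin n) : ∑ σ, μ σ * excess p i σ ≤ p i := by
  rcases (hp.1 i).eq_or_lt with hi | hi
  · exact (sum_eq_zero fun σ _ => hμ.mul_excess_eq_zero hp hi.symm σ).trans_le (hp.1 i)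
  have hsum : ∑ σ, μ σ * p i * (#(overtaken i σ) + 1) =
      ∑ σ, μ σ * (#(overtaken i σ) * p i) + p i := by
    simp only [mul_add, sum_add_distrib, mul_one, ← sum_mul, hμ.1.2, one_mul]
    exact congrArg (· + p i) (sum_congr rfl fun σ _ => by ring)
  have h := (hμ.sum_overtaken_le_sum_card_mul hp hp_anti hi).trans
    (hμ.sum_card_mul_le hp hp_anti hi)
  simp only [excess, sum_sub_distrib, sum_const, nsmul_eq_mul, mul_sub]
  linarith

lemma IsStationary.expectedCost_le (hμ : IsStationary p μ) (hp : p ∈ stdSimplex ℝ (Fin n))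
    (hp_anti : Antitone p) : expectedCost p μ ≤ opt p + 1 := by
  calc expectedCost p μ = opt p + ∑ i, ∑ σ, μ σ * excess p i σ := by
        simp only [expectedCost, cost_eq_opt_add_sum_excess, mul_add, sum_add_distrib]
        rw [← sum_mul, hμ.1.2, one_mul, sum_comm]
        simp only [mul_sum]
    _ ≤ opt p + ∑ i, p i :=
        add_le_add_right (sum_le_sum fun i _ => hμ.sum_mul_excess_le hp hp_anti i) _
    _ = opt p + 1 := by rw [hp.2]

end Excess

end ListUpdate

theorem theorem1 (n : ℕ) (p : Fin n → ℝ) (hp_nonneg : ∀ i, 0 ≤ p i)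
    (hp_sum : ∑ i, p i = 1) (hp_anti : Antitone p) :
    (∃ μ : Equiv.Perm (Fin n) → ℝ, ListUpdate.IsStationary p μ) ∧
    ((∀ i, 0 < p i) → ∃! μ : Equiv.Perm (Fin n) → ℝ, ListUpdate.IsStationary p μ) ∧
    ∀ μ : Equiv.Perm (Fin n) → ℝ, ListUpdate.IsStationary p μ →
      ListUpdate.expectedCost p μ ≤ ListUpdate.opt p + 1 := by
  have hp : p ∈ stdSimplex ℝ (Fin n) := ⟨hp_nonneg, hp_sum⟩
  have hν := ListUpdate.isStationary_weight_div_sum hp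
  refine ⟨⟨_, hν⟩, fun hp_pos => ⟨_, hν, fun μ hμ => ?_⟩, fun μ hμ => ?_⟩
  · exact hμ.eq_weight_div_sum hp fun i => (hp_pos i).ne'
  · exact hμ.expectedCost_le hp hp_anti
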